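/- A partially ordered group is a group $G$ with a partial order $\le$ such that $a\le b$ implies $sat\le sbt$ for all $a,b,s,t\in G$; an $\ell$-group is a partially ordered group whose order is a lattice order. An $\ell$-group is representable if it is a subdirect product of totally ordered groups. A variety of $\ell$-groups is a class of $\ell$-groups defined by equations in the language of $\ell$-groups. Let $G$ be a partially ordered group with identity $\mathrm e$ and $G^+=\{a\in G: a\ge \mathrm e\}$. A right pre-order on $G$ is a reflexive, transitive, total relation $\preceq\,\neq G\times G$ that extends $\le$ and satisfies $a\preceq b\Rightarrow at\preceq bt$. It is identified with its positive cone $C=\{a: \mathrm e\preceq a\}$ (so $a\preceq b$ iff $ba^{-1}\in C$); the sets arising in this way are exactly the proper submonoids $C\subsetneq G$ with $G^+\subseteq C$ and $G=C\cup C^{-1}$. A right pre-order is called a pre-order if it is also left-invariant, equivalently if $t^{-1}Ct\subseteq C$ for all $t\in G$. For a right pre-order $C$ let $\Omega_C$ be the chain obtained as the quotient of $G$ by the equivalence $a\preceq b\preceq a$. Let $\operatorname{Aut}(\Omega_C)$ be the $\ell$-group of its order-preserving bijections, with pointwise lattice operations and with product $fg$ standing for "$g$ after $f$", and let $H_C$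 be the $\ell$-subgroup of $\operatorname{Aut}(\Omega_C)$ generated by the maps $[b]\mapsto[ba]$, $a\in G$. For a variety $\mathsf V$ of $\ell$-groups, let $\mathcal P_{\mathsf V}(G)$ be the set of right pre-orders $C$ on $G$ with $H_C\in\mathsf V$, ordered by inclusion and endowed with the smallest topology containing all the sets $\{C: a\in C,\ a^{-1}\notin C\}$, $a\in G$. Let $\mathcal B_{\mathsf V}(G)\subseteq\mathcal P_{\mathsf V}(G)$ be the subset of pre-orders, with the subspace topology. A topological space is generalised spectral if every nonempty irreducible closed subset is the closure of a unique point and the compact open subsets form a base that is closed under (nonempty) finite intersections. **Theorem 7.9.** Let $G$ be any partially ordered group and let $\mathsf V$ be any variety of $\ell$-groups all of whose members are representable. 1. The space $\mathcal B_{\mathsf V}(G)$ is generalised spectral. 2. The assignment $\beta(C)=\bigcap_{t\in G}t^{-1}Ct$ defines a map $\beta\colon\mathcal P_{\mathsf V}(G)\to\mathcal P_{\mathsf V}(G)$ that is an interior operator (that is, $\beta(C)\subseteq C$; $C\subseteq D$ implies $\beta(C)\subseteq\beta(D)$; and $\beta\circ\beta=\beta$), and $\mathcal B_{\mathsf V}(G)$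 is exactly the set of its open elements, i.e. of the $C$ with $\beta(C)=C$. Moreover, $\beta\colon\mathcal P_{\mathsf V}(G)\to\mathcal B_{\mathsf V}(G)$ is a continuous retraction: it takes values in $\mathcal B_{\mathsf V}(G)$, is continuous, and restricts to the identity on $\mathcal B_{\mathsf V}(G)$. -/

import Mathlib

universe u v

/-! ### Lattice-ordered groups: terms, varieties, representability

An `ℓ`-group is a type with instances `Group`, `Lattice`, `MulLeftMono`, `MulRightMono`. -/

/-- Terms in the language of `ℓ`-groups, over countably many variables. -/
inductive LTerm : Type
  | var : ℕ → LTerm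
  | one : LTerm
  | mul : LTerm → LTerm → LTerm
  | inv : LTerm → LTerm
  | sup : LTerm → LTerm → LTerm
  | inf : LTerm → LTerm → LTerm

/-- The value of a term under an assignment of its variables. -/
def LTerm.eval {H : Type v} [Group H] [Lattice H] (x : ℕ → H) : LTerm → H
  | .var n => x n
  | .one => 1
  | .mul s t => s.eval x * t.eval x
  | .inv s => (s.eval x)⁻¹
  | .sup s t => s.eval x ⊔ t.eval x
  | .inf s t => s.eval x ⊓ t.eval x

/-- A variety (equationally definable class) of `ℓ`-groups, given by a set of defining
equations. -/
structure LGroupVariety : Type where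
  equations : Set (LTerm × LTerm)

/-- The `ℓ`-group `H` belongs to the variety `V`: it satisfies all defining equations. -/
def LGroupVariety.Mem (V : LGroupVariety) (H : Type v) [Group H] [Lattice H]
    [MulLeftMono H] [MulRightMono H] : Prop :=
  ∀ e ∈ V.equations, ∀ x : ℕ → H, e.1.eval x = e.2.eval x

/-- An `ℓ`-group is representable if it is a subdirect product of totally ordered groups. -/
def IsRepresentableLGroup (H : Type v) [Group H] [Lattice H]
    [MulLeftMono H] [MulRightMono H] : Prop :=
  ∃ (ι : Type v) (T : ι → Type v) (_ : ∀ i, Group (T i)) (_ : ∀ i, LinearOrder (T i))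
    (_ : ∀ i, MulLeftMono (T i)) (_ : ∀ i, MulRightMono (T i)) (φ : H →* (∀ i, T i)),
    Function.Injective φ ∧
    (∀ x y, φ (x ⊔ y) = φ x ⊔ φ y) ∧
    (∀ x y, φ (x ⊓ y) = φ x ⊓ φ y) ∧
    (∀ i, Function.Surjective fun x => φ x i)

/-- All members of `V` (in the universe at hand) are representable. -/
def LGroupVariety.IsRepresentable (V : LGroupVariety) : Prop :=
  ∀ (H : Type u) [Group H] [Lattice H] [MulLeftMono H] [MulRightMono H],
    V.Mem H → IsRepresentableLGroup H

/-! ### The `ℓ`-subgroup generated by a set -/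

/-- The `ℓ`-subgroup (sublattice subgroup) generated by a subset. -/
def lClosure {H : Type v} [Group H] [Lattice H] (S : Set H) : Subgroup H :=
  sInf {K : Subgroup H | S ⊆ K ∧ ∀ x ∈ K, ∀ y ∈ K, x ⊔ y ∈ K ∧ x ⊓ y ∈ K}

section lClosure

variable {H : Type v} [Group H] [Lattice H] {S : Set H}

theorem sup_mem_lClosure {x y : H} (hx : x ∈ lClosure S) (hy : y ∈ lClosure S) :
    x ⊔ y ∈ lClosure S :=
  Subgroup.mem_sInf.2 fun K hK =>
    (hK.2 x (Subgroup.mem_sInf.1 hx K hK) y (Subgroup.mem_sInf.1 hy K hK)).1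

theorem inf_mem_lClosure {x y : H} (hx : x ∈ lClosure S) (hy : y ∈ lClosure S) :
    x ⊓ y ∈ lClosure S :=
  Subgroup.mem_sInf.2 fun K hK =>
    (hK.2 x (Subgroup.mem_sInf.1 hx K hK) y (Subgroup.mem_sInf.1 hy K hK)).2

instance : Lattice (lClosure S) :=
  Subtype.lattice (fun _ _ hx hy => sup_mem_lClosure hx hy)
    (fun _ _ hx hy => inf_mem_lClosure hx hy)

instance [MulLeftMono H] : MulLeftMono (lClosure S) :=
  ⟨fun a _ _ h => mul_le_mul_right (α := H) h a⟩

instance [MulRightMono H] : MulRightMono (lClosure S) :=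
  ⟨fun a _ _ h => mul_le_mul_left (α := H) h a⟩

end lClosure

/-! ### The `ℓ`-group of order-automorphisms of a chain -/

/-- The order-preserving bijections of a chain, with product `f * g` standing for
"`g` after `f`" and with the pointwise order. -/
structure ChainAut (Ω : Type v) [LinearOrder Ω] where
  toOrderIso : Ω ≃o Ω

namespace ChainAut

variable {Ω : Type v} [LinearOrder Ω]

instance : CoeFun (ChainAut Ω) fun _ => Ω → Ω := ⟨fun f => f.toOrderIso⟩

@[ext] theorem ext {f g : ChainAut Ω} (h : ∀ w, f w = g w) : f = g := by
  cases f; cases g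
  congr 1
  exact OrderIso.ext (funext h)

instance : Group (ChainAut Ω) where
  mul f g := ⟨f.toOrderIso.trans g.toOrderIso⟩
  one := ⟨OrderIso.refl Ω⟩
  inv f := ⟨f.toOrderIso.symm⟩
  mul_assoc _ _ _ := rfl
  one_mul _ := rfl
  mul_one _ := rfl
  inv_mul_cancel f := ext fun w => f.toOrderIso.apply_symm_apply w

@[simp] theorem mul_apply (f g : ChainAut Ω) (w : Ω) : (f * g) w = g (f w) := rfl

@[simp] theorem one_apply (w : Ω) : (1 : ChainAut Ω) w = w := rfl

instance : PartialOrder (ChainAut Ω) where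
  le f g := ∀ w, f w ≤ g w
  le_refl _ _ := le_rfl
  le_trans _ _ _ h k w := (h w).trans (k w)
  le_antisymm _ _ h k := ext fun w => le_antisymm (h w) (k w)

/-- The pointwise supremum. -/
def supIso (f g : Ω ≃o Ω) : Ω ≃o Ω :=
  StrictMono.orderIsoOfRightInverse (fun w => f w ⊔ g w)
    (fun _ _ h => max_lt_max (f.strictMono h) (g.strictMono h))
    (fun w => f.symm w ⊓ g.symm w) (fun w => by
      rcases le_total (f.symm w) (g.symm w) with h | h
      · have : g (f.symm w) ≤ w := by simpa using g.monotone h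
        simp [h, this]
      · have : f (g.symm w) ≤ w := by simpa using f.monotone h
        simp [h, this])

/-- The pointwise infimum. -/
def infIso (f g : Ω ≃o Ω) : Ω ≃o Ω :=
  StrictMono.orderIsoOfRightInverse (fun w => f w ⊓ g w)
    (fun _ _ h => min_lt_min (f.strictMono h) (g.strictMono h))
    (fun w => f.symm w ⊔ g.symm w) (fun w => by
      rcases le_total (f.symm w) (g.symm w) with h | h
      · have : w ≤ f (g.symm w) := by simpa using f.monotone h
        simp [h, this]
      · have : w ≤ g (f.symm w) := by simpa using g.monotone h
        simp [h, this])

instance : Lattice (ChainAut Ω) where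
  sup f g := ⟨supIso f.toOrderIso g.toOrderIso⟩
  inf f g := ⟨infIso f.toOrderIso g.toOrderIso⟩
  le_sup_left _ _ _ := le_max_left _ _
  le_sup_right _ _ _ := le_max_right _ _
  sup_le _ _ _ h k w := max_le (h w) (k w)
  inf_le_left _ _ _ := min_le_left _ _
  inf_le_right _ _ _ := min_le_right _ _
  le_inf _ _ _ h k w := le_min (h w) (k w)

@[simp] theorem sup_apply (f g : ChainAut Ω) (w : Ω) : (f ⊔ g) w = f w ⊔ g w := rfl

@[simp] theorem inf_apply (f g : ChainAut Ω) (w : Ω) : (f ⊓ g) w = f w ⊓ g w := rfl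

instance : MulLeftMono (ChainAut Ω) := ⟨fun f _ _ h w => h (f w)⟩

instance : MulRightMono (ChainAut Ω) := ⟨fun f _ _ h w => f.toOrderIso.monotone (h w)⟩

end ChainAut

/-! ### Right pre-orders on a partially ordered group

A partially ordered group is a type with instances `Group`, `PartialOrder`, `MulLeftMono`,
`MulRightMono`. Right pre-orders (right-invariant, proper, total, extending the partial order)
are identified with their positive cones. -/

/-- A pre-cone of a partially ordered group `G`: a proper submonoid `C` with
`G = C ∪ C⁻¹` that contains the positive cone of `G`. -/
structure PreCone (G : Type u) [Group G] [PartialOrder G] extends Submonoid G where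
  proper : carrier ≠ Set.univ
  total : ∀ a : G, a ∈ carrier ∨ a⁻¹ ∈ carrier
  pos_mem : ∀ a : G, 1 ≤ a → a ∈ carrier

namespace PreCone

section

variable {G : Type u} [Group G] [PartialOrder G]

instance : SetLike (PreCone G) G where
  coe C := C.carrier
  coe_injective C D h := by
    rcases C with ⟨⟨⟨_, _⟩, _⟩, _, _, _⟩
    rcases D with ⟨⟨⟨_, _⟩, _⟩, _, _, _⟩
    congr

/-- Pre-cones are ordered by inclusion. -/
instance : PartialOrder (PreCone G) :=
  PartialOrder.lift (fun C : PreCone G => (C : Set G)) SetLike.coe_injective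

/-- The right pre-order with positive cone `C`. -/
def Rel (C : PreCone G) (a b : G) : Prop := b * a⁻¹ ∈ C

theorem Rel.refl (C : PreCone G) (a : G) : C.Rel a a := by
  show a * a⁻¹ ∈ C.toSubmonoid
  rw [mul_inv_cancel]; exact C.toSubmonoid.one_mem

theorem Rel.trans {C : PreCone G} {a b c : G} (h : C.Rel a b) (k : C.Rel b c) : C.Rel a c := by
  have := C.toSubmonoid.mul_mem k h
  rwa [show c * b⁻¹ * (b * a⁻¹) = c * a⁻¹ by group] at this

theorem Rel.total (C : PreCone G) (a b : G) : C.Rel a b ∨ C.Rel b a := by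
  have := C.total (b * a⁻¹)
  rwa [mul_inv_rev, inv_inv] at this

theorem rel_mul_right_iff {C : PreCone G} {a b : G} (t : G) :
    C.Rel (a * t) (b * t) ↔ C.Rel a b := by
  unfold Rel
  rw [show b * t * (a * t)⁻¹ = b * a⁻¹ by group]

/-- The equivalence relation on `G` induced by the right pre-order `C`. -/
def setoid (C : PreCone G) : Setoid G where
  r a b := C.Rel a b ∧ C.Rel b a
  iseqv := ⟨fun a => ⟨.refl C a, .refl C a⟩, fun h => ⟨h.2, h.1⟩,
    fun h k => ⟨h.1.trans k.1, k.2.trans h.2⟩⟩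

/-- The chain `Ω_C`: the quotient of `G` modulo the equivalence induced by `C`. -/
def Omega (C : PreCone G) : Type u := Quotient C.setoid

/-- The class `[a]` of `a` in `Ω_C`. -/
def cls (C : PreCone G) (a : G) : C.Omega := Quotient.mk C.setoid a

noncomputable instance (C : PreCone G) : LinearOrder C.Omega where
  le := Quotient.lift₂ C.Rel fun _ _ _ _ h k => propext
    ⟨fun l => (h.2.trans l).trans k.1, fun l => (h.1.trans l).trans k.2⟩
  le_refl := by rintro ⟨a⟩; exact Rel.refl C a
  le_trans := by rintro ⟨a⟩ ⟨b⟩ ⟨c⟩ h k; exact Rel.trans h k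
  le_antisymm := by rintro ⟨a⟩ ⟨b⟩ h k; exact Quotient.sound ⟨h, k⟩
  le_total := by rintro ⟨a⟩ ⟨b⟩; exact Rel.total C a b
  toDecidableLE := Classical.decRel _

theorem cls_le_cls {C : PreCone G} {a b : G} : C.cls a ≤ C.cls b ↔ C.Rel a b := Iff.rfl

/-- Right multiplication by `a` on the chain `Ω_C`: the map `[b] ↦ [b * a]`. -/
def mulRight (C : PreCone G) (a : G) : C.Omega → C.Omega :=
  Quotient.map (fun b => b * a)
    fun _ _ h => ⟨(rel_mul_right_iff a).2 h.1, (rel_mul_right_iff a).2 h.2⟩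

/-- The action `ρ_C` of `G` on `Ω_C`, `ρ_C(a)([b]) = [b * a]`. -/
def rho (C : PreCone G) (a : G) : ChainAut C.Omega where
  toOrderIso :=
    { toFun := C.mulRight a
      invFun := C.mulRight a⁻¹
      left_inv := by
        rintro ⟨b⟩
        show C.cls (b * a * a⁻¹) = C.cls b
        rw [mul_inv_cancel_right]
      right_inv := by
        rintro ⟨b⟩
        show C.cls (b * a⁻¹ * a) = C.cls b
        rw [inv_mul_cancel_right]
      map_rel_iff' := by
        rintro ⟨b⟩ ⟨c⟩
        exact rel_mul_right_iff a }

@[simp] theorem rho_cls (C : PreCone G) (a b : G) : C.rho a (C.cls b) = C.cls (b * a) := rfl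

/-- The `ℓ`-group `H_C`: the `ℓ`-subgroup of `Aut(Ω_C)` generated by the image of `ρ_C`. -/
abbrev H (C : PreCone G) : Type u := lClosure (Set.range C.rho)

/-- The right pre-order `C` is a pre-order, that is, the pre-cone `C` is normal
(closed under conjugation). -/
def IsNormal (C : PreCone G) : Prop := ∀ a ∈ C, ∀ t : G, t⁻¹ * a * t ∈ C

/-- Normality of the cone means that the right pre-order is also left-invariant. -/
theorem isNormal_iff_leftInvariant (C : PreCone G) :
    C.IsNormal ↔ ∀ a b t : G, C.Rel a b → C.Rel (t * a) (t * b) := by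
  constructor
  · intro h a b t hab
    have := h _ hab t⁻¹
    rwa [show t⁻¹⁻¹ * (b * a⁻¹) * t⁻¹ = t * b * (t * a)⁻¹ by group] at this
  · intro h a ha t
    have := h 1 a t⁻¹ (by simpa [Rel] using ha)
    simpa [Rel] using this

end

end PreCone

/-! ### The spaces of right pre-orders and of pre-orders of a variety -/

/-- The set of right pre-orders `C` on `G` such that `H_C` belongs to the variety `V`,
ordered by inclusion. -/
abbrev RightPreorders (V : LGroupVariety) (G : Type u) [Group G] [PartialOrder G] : Type u :=
  {C : PreCone G // V.Mem C.H}

/-- The subbasic open set of all `C` with `a ∈ C` and `a⁻¹ ∉ C`. -/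
def RightPreorders.basicOpen (V : LGroupVariety) {G : Type u} [Group G] [PartialOrder G]
    (a : G) : Set (RightPreorders V G) :=
  {C | a ∈ C.1 ∧ a⁻¹ ∉ C.1}

/-- The smallest topology containing all the sets `basicOpen V a`. -/
instance RightPreorders.instTopologicalSpace (V : LGroupVariety) (G : Type u) [Group G]
    [PartialOrder G] : TopologicalSpace (RightPreorders V G) :=
  TopologicalSpace.generateFrom (Set.range (RightPreorders.basicOpen V))

/-- The (two-sided) pre-orders among the right pre-orders of the variety `V`. -/
def Preorders (V : LGroupVariety) (G : Type u) [Group G] [PartialOrder G] :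
    Set (RightPreorders V G) :=
  {C | C.1.IsNormal}

/-! ### Interior operators and generalised spectral spaces -/

/-- Interior operators on a partially ordered set. -/
structure IsInteriorOperator {S : Type v} [PartialOrder S] (f : S → S) : Prop where
  contracting : ∀ x, f x ≤ x
  monotone : Monotone f
  idempotent : ∀ x, f (f x) = f x

/-- A generalised spectral space: a sober space (every nonempty irreducible closed set is the
closure of a unique point) whose compact open subsets form a base closed under finite
intersections. Compactness of the whole space is not required. -/
structure IsGeneralisedSpectral (X : Type v) [TopologicalSpace X] : Prop where
  sober : ∀ Y : Set X, IsClosed Y → IsIrreducible Y → ∃! x : X, closure {x} = Y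
  isTopologicalBasis : TopologicalSpace.IsTopologicalBasis {U : Set X | IsOpen U ∧ IsCompact U}
  isCompact_inter : ∀ U W : Set X, IsOpen U → IsCompact U → IsOpen W → IsCompact W →
    IsCompact (U ∩ W)

/-! Write `core C` for the intersection of the conjugates of `C`. If `H_C` is representable, its
elements satisfy an orthogonality identity which forces `core C` to be total
(`core_total_of_isRepresentable`). Since `ρ a ≤ ρ b` iff `b * a⁻¹ ∈ core C`, the image of `G` in
`Aut(Ω_C)` is then a chain, so it is all of `H_C`, and membership of `H_C` in `V` depends on `core
C` alone (`variety_mem_H_iff`). Hence `β` stays inside the space; its other properties are formal.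

For normal `C` the core is `C` itself, so membership in `V`, like the cone axioms, is tested on
finitely many elements at a time. A proper set finitely approximated by pre-orders of `V` is
therefore again one (`exists_coe_eq`). Applied to ultrafilter limits this gives compactness; applied
to `⋂ Y` it gives generic points. -/

theorem LTerm.eval_map {H K : Type*} [Group H] [Lattice H] [Group K] [Lattice K] (φ : H →* K)
    (hsup : ∀ x y, φ (x ⊔ y) = φ x ⊔ φ y) (hinf : ∀ x y, φ (x ⊓ y) = φ x ⊓ φ y)
    (x : ℕ → H) (t : LTerm) : φ (t.eval x) = t.eval (fun n => φ (x n)) := by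
  induction t <;> simp_all [LTerm.eval]

/-- In a representable `ℓ`-group, the positive part of an element is orthogonal to every conjugate
of its negative part. -/
theorem IsRepresentableLGroup.sup_one_inf_conj_eq_one {H : Type v} [Group H] [Lattice H]
    [MulLeftMono H] [MulRightMono H] (h : IsRepresentableLGroup H) (x y : H) :
    (x ⊔ 1) ⊓ (y⁻¹ * (x⁻¹ ⊔ 1) * y) = 1 := by
  obtain ⟨ι, T, _, _, _, _, φ, hφ, hsup, hinf, -⟩ := h
  apply hφ
  funext i
  simp only [hinf, hsup, map_mul, map_inv, map_one, Pi.inf_apply, Pi.sup_apply, Pi.mul_apply,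
    Pi.inv_apply, Pi.one_apply]
  rcases le_total (φ x i) 1 with hx | hx
  · have h1 : (1 : T i) ≤ (φ y i)⁻¹ * ((φ x i)⁻¹ ⊔ 1) * φ y i := by
      calc (1 : T i) = (φ y i)⁻¹ * 1 * φ y i := by simp
        _ ≤ _ := by gcongr; exact le_sup_right
    rw [sup_eq_right.2 hx, inf_eq_left.2 h1]
  · rw [sup_eq_right.2 (inv_le_one'.2 hx)]
    simp

/-! ### Evaluating terms in a total pre-order, and its finite character. -/

open Classical in
/-- The value of a term under an assignment in a group `G` whose lattice operations are those of
the total pre-order with positive cone `D`. -/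
noncomputable def LTerm.coneEval {G : Type u} [Group G] (D : Set G) (x : ℕ → G) : LTerm → G
  | .var n => x n
  | .one => 1
  | .mul s t => s.coneEval D x * t.coneEval D x
  | .inv s => (s.coneEval D x)⁻¹
  | .sup s t =>
      if t.coneEval D x * (s.coneEval D x)⁻¹ ∈ D then t.coneEval D x else s.coneEval D x
  | .inf s t =>
      if t.coneEval D x * (s.coneEval D x)⁻¹ ∈ D then s.coneEval D x else t.coneEval D x

/-- Each `⊔` or `⊓` in the term consults the cone about a single element, so finitely many
membership questions determine the value. -/
theorem LTerm.exists_finset_coneEval_eq {G : Type u} [Group G] (D : Set G) (x : ℕ → G)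
    (t : LTerm) : ∃ F : Finset G, ∀ E : Set G, (∀ a ∈ F, a ∈ E ↔ a ∈ D) →
      t.coneEval E x = t.coneEval D x := by
  classical
  induction t with
  | var n => exact ⟨∅, fun _ _ => rfl⟩
  | one => exact ⟨∅, fun _ _ => rfl⟩
  | inv s hs =>
    obtain ⟨F, hF⟩ := hs
    exact ⟨F, fun E hE => by simp only [coneEval, hF E hE]⟩
  | mul s t hs ht =>
    obtain ⟨F, hF⟩ := hs
    obtain ⟨F', hF'⟩ := ht
    refine ⟨F ∪ F', fun E hE => ?_⟩
    simp only [coneEval, hF E fun a ha => hE a (Finset.mem_union_left _ ha),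
      hF' E fun a ha => hE a (Finset.mem_union_right _ ha)]
  | sup s t hs ht =>
    obtain ⟨F, hF⟩ := hs
    obtain ⟨F', hF'⟩ := ht
    refine ⟨insert (t.coneEval D x * (s.coneEval D x)⁻¹) (F ∪ F'), fun E hE => ?_⟩
    simp only [coneEval,
      hF E fun a ha => hE a (Finset.mem_insert_of_mem (Finset.mem_union_left _ ha)),
      hF' E fun a ha => hE a (Finset.mem_insert_of_mem (Finset.mem_union_right _ ha)),
      hE _ (Finset.mem_insert_self _ _)]
  | inf s t hs ht =>
    obtain ⟨F, hF⟩ := hs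
    obtain ⟨F', hF'⟩ := ht
    refine ⟨insert (t.coneEval D x * (s.coneEval D x)⁻¹) (F ∪ F'), fun E hE => ?_⟩
    simp only [coneEval,
      hF E fun a ha => hE a (Finset.mem_insert_of_mem (Finset.mem_union_left _ ha)),
      hF' E fun a ha => hE a (Finset.mem_insert_of_mem (Finset.mem_union_right _ ha)),
      hE _ (Finset.mem_insert_self _ _)]

/-- The equations of `V` hold in the quotient of `G` by the pre-order with positive cone `D`. -/
def LGroupVariety.HoldsInCone (V : LGroupVariety) {G : Type u} [Group G] (D : Set G) : Prop :=
  ∀ e ∈ V.equations, ∀ x : ℕ → G,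
    e.1.coneEval D x * (e.2.coneEval D x)⁻¹ ∈ D ∧ e.2.coneEval D x * (e.1.coneEval D x)⁻¹ ∈ D

/-- The equations of `V` hold in a cone that is finitely approximated by cones in which they
hold. -/
theorem LGroupVariety.HoldsInCone.of_finset {V : LGroupVariety} {G : Type u} [Group G] {D : Set G}
    (h : ∀ F : Finset G, ∃ E : Set G, V.HoldsInCone E ∧ ∀ a ∈ F, a ∈ E ↔ a ∈ D) :
    V.HoldsInCone D := by
  classical
  intro e he x
  obtain ⟨F, hF⟩ := e.1.exists_finset_coneEval_eq D x
  obtain ⟨F', hF'⟩ := e.2.exists_finset_coneEval_eq D x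
  obtain ⟨E, hE, hED⟩ := h
    (insert (e.1.coneEval D x * (e.2.coneEval D x)⁻¹)
      (insert (e.2.coneEval D x * (e.1.coneEval D x)⁻¹) (F ∪ F')))
  have := hE e he x
  rw [hF E fun a ha => hED a (by simp [ha]), hF' E fun a ha => hED a (by simp [ha])] at this
  rwa [hED _ (by simp), hED _ (by simp)] at this

theorem subset_lClosure {H : Type v} [Group H] [Lattice H] {S : Set H} : S ⊆ lClosure S :=
  fun _ hx => Subgroup.mem_sInf.2 fun _ hK => hK.1 hx

/-! ### The core of a right pre-order and the structure of `H_C`. -/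

namespace PreCone

section

variable {G : Type u} [Group G] [PartialOrder G]

theorem mul_mem (C : PreCone G) {a b : G} (ha : a ∈ C) (hb : b ∈ C) : a * b ∈ C :=
  C.toSubmonoid.mul_mem ha hb

theorem one_mem (C : PreCone G) : (1 : G) ∈ C := C.toSubmonoid.one_mem

theorem mem_or_inv_mem (C : PreCone G) (a : G) : a ∈ C ∨ a⁻¹ ∈ C := C.total a

theorem mem_of_inv_notMem {C : PreCone G} {a : G} (h : a⁻¹ ∉ C) : a ∈ C :=
  (C.mem_or_inv_mem a).resolve_right h

theorem exists_inv_notMem (C : PreCone G) : ∃ a : G, a⁻¹ ∉ C := by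
  obtain ⟨a, ha⟩ := (Set.ne_univ_iff_exists_notMem _).1 C.proper
  exact ⟨a⁻¹, by rwa [inv_inv]⟩

theorem exists_cls_eq (C : PreCone G) (w : C.Omega) : ∃ a, C.cls a = w := Quotient.exists_rep w

/-- The action of `G` on `Ω_C` as a homomorphism. -/
def rhoHom (C : PreCone G) : G →* ChainAut C.Omega where
  toFun := C.rho
  map_one' := ChainAut.ext fun w => by
    obtain ⟨b, rfl⟩ := C.exists_cls_eq w
    simp
  map_mul' a a' := ChainAut.ext fun w => by
    obtain ⟨b, rfl⟩ := C.exists_cls_eq w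
    simp [mul_assoc]

theorem rho_one (C : PreCone G) : C.rho 1 = 1 := C.rhoHom.map_one

theorem rho_mul (C : PreCone G) (a b : G) : C.rho (a * b) = C.rho a * C.rho b :=
  C.rhoHom.map_mul a b

theorem rho_inv (C : PreCone G) (a : G) : C.rho a⁻¹ = (C.rho a)⁻¹ := C.rhoHom.map_inv a

/-- The intersection of the conjugates of `C`. -/
def core (C : PreCone G) : Set G := {a | ∀ t : G, t * a * t⁻¹ ∈ C}

theorem core_subset (C : PreCone G) : C.core ⊆ C := fun a ha => by simpa using ha 1

theorem core_eq_iInter (C : PreCone G) :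
    C.core = ⋂ t : G, (fun c => t⁻¹ * c * t) '' (C : Set G) := by
  ext a
  simp only [Set.mem_iInter, Set.mem_image, core, Set.mem_ofPred_eq]
  refine forall_congr' fun t => ⟨fun h => ⟨_, h, by group⟩, ?_⟩
  rintro ⟨c, hc, rfl⟩
  simpa [mul_assoc] using hc

theorem rho_le_rho_iff (C : PreCone G) (a b : G) : C.rho a ≤ C.rho b ↔ b * a⁻¹ ∈ C.core := by
  constructor
  · intro h t
    have := cls_le_cls.1 (h (C.cls t))
    simpa [Rel, mul_assoc] using this
  · intro h w
    obtain ⟨t, rfl⟩ := C.exists_cls_eq w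
    have := h t
    refine cls_le_cls.2 ?_
    simpa [Rel, mul_assoc] using this

theorem isNormal_iff_core_eq (C : PreCone G) : C.IsNormal ↔ C.core = C := by
  constructor
  · exact fun h => C.core_subset.antisymm fun a ha t => by simpa using h a ha t⁻¹
  · intro h a ha t
    have : a ∈ C.core := h ▸ ha
    simpa using this t⁻¹

/-- Otherwise `a` strictly raises some point `[t]` and `a⁻¹` strictly raises some `[s]`. Conjugating
by `s⁻¹ * t`, which carries `[s]` to `[t]`, makes both positive parts move `[t]`, against their
orthogonality. -/
theorem core_total_of_isRepresentable {C : PreCone G} (hC : IsRepresentableLGroup C.H) (a : G) :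
    a ∈ C.core ∨ a⁻¹ ∈ C.core := by
  by_contra! hcon
  obtain ⟨h1, h2⟩ := hcon
  simp only [core, Set.mem_ofPred_eq, not_forall] at h1 h2
  obtain ⟨s, hs⟩ := h1
  obtain ⟨t, ht⟩ := h2
  have key := congrArg Subtype.val (hC.sup_one_inf_conj_eq_one
    ⟨C.rho a, subset_lClosure ⟨a, rfl⟩⟩ ⟨C.rho (s⁻¹ * t), subset_lClosure ⟨_, rfl⟩⟩)
  have key : (C.rho a ⊔ 1) ⊓ ((C.rho (s⁻¹ * t))⁻¹ * ((C.rho a)⁻¹ ⊔ 1) * C.rho (s⁻¹ * t)) = 1 := key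
  rw [← rho_inv, ← rho_inv] at key
  have hlt := congrArg (fun f : ChainAut C.Omega => f (C.cls t)) key
  have hs' : C.cls s < C.cls (s * a⁻¹) := by
    rw [← not_le, cls_le_cls]
    simpa [Rel, mul_assoc] using hs
  have ht' : C.cls t < C.cls (t * a) := by
    rw [← not_le, cls_le_cls]
    simpa [Rel, mul_assoc] using ht
  have hst : C.cls t < C.rho (s⁻¹ * t) (C.cls (s * a⁻¹)) := by
    have := (C.rho (s⁻¹ * t)).toOrderIso.strictMono hs'
    simpa using this
  simp only [ChainAut.inf_apply, ChainAut.sup_apply, ChainAut.mul_apply, ChainAut.one_apply,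
    rho_cls] at hlt
  have e : t * (s⁻¹ * t)⁻¹ = s := by group
  rw [e, max_eq_left hs'.le, max_eq_left ht'.le] at hlt
  exact (lt_min ht' hst).ne' hlt

/-- A total core makes the `ρ a` pairwise comparable, so each join or meet is one of its two
arguments, selected by the core. -/
theorem eval_rho {C : PreCone G} (hC : ∀ a, a ∈ C.core ∨ a⁻¹ ∈ C.core) (x : ℕ → G) (t : LTerm) :
    t.eval (fun n => C.rho (x n)) = C.rho (t.coneEval C.core x) := by
  have hle : ∀ a b, b * a⁻¹ ∉ C.core → C.rho b ≤ C.rho a := fun a b h => by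
    rw [rho_le_rho_iff]
    simpa using (hC (b * a⁻¹)).resolve_left h
  induction t with
  | var n => rfl
  | one => exact C.rho_one.symm
  | mul s t hs ht => simp only [LTerm.eval, LTerm.coneEval, rho_mul, hs, ht]
  | inv s hs => simp only [LTerm.eval, LTerm.coneEval, rho_inv, hs]
  | sup s t hs ht =>
    simp only [LTerm.eval, LTerm.coneEval, hs, ht]
    split_ifs with h
    · exact sup_eq_right.2 ((C.rho_le_rho_iff _ _).2 h)
    · exact sup_eq_left.2 (hle _ _ h)
  | inf s t hs ht =>
    simp only [LTerm.eval, LTerm.coneEval, hs, ht]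
    split_ifs with h
    · exact inf_eq_left.2 ((C.rho_le_rho_iff _ _).2 h)
    · exact inf_eq_right.2 (hle _ _ h)

theorem mem_range_rho_of_mem_lClosure {C : PreCone G} (hC : ∀ a, a ∈ C.core ∨ a⁻¹ ∈ C.core)
    {f : ChainAut C.Omega} (hf : f ∈ lClosure (Set.range C.rho)) : ∃ a, C.rho a = f := by
  refine Subgroup.mem_sInf.1 hf C.rhoHom.range ⟨?_, ?_⟩
  · rintro _ ⟨a, rfl⟩
    exact ⟨a, rfl⟩
  · rintro _ ⟨a, rfl⟩ _ ⟨b, rfl⟩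
    -- Closure under `⊔` and `⊓` is `eval_rho` for the two-variable terms, with `a` and `b` as the
    -- values of variables 0 and 1.
    let x : ℕ → G := fun n => if n = 0 then a else b
    exact ⟨⟨_, (eval_rho hC x (.sup (.var 0) (.var 1))).symm⟩,
      ⟨_, (eval_rho hC x (.inf (.var 0) (.var 1))).symm⟩⟩

theorem variety_mem_H_iff (V : LGroupVariety) {C : PreCone G}
    (hC : ∀ a, a ∈ C.core ∨ a⁻¹ ∈ C.core) : V.Mem C.H ↔ V.HoldsInCone C.core := by
  have hval : ∀ (x : ℕ → C.H) (t : LTerm), (t.eval x : C.H).1 = t.eval fun n => (x n).1 :=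
    fun x t => t.eval_map (lClosure (Set.range C.rho)).subtype (fun _ _ => rfl) (fun _ _ => rfl) x
  have heq : ∀ a b, C.rho a = C.rho b ↔ a * b⁻¹ ∈ C.core ∧ b * a⁻¹ ∈ C.core := fun a b => by
    rw [le_antisymm_iff, rho_le_rho_iff, rho_le_rho_iff, and_comm]
  constructor
  · intro h e he x
    have := congrArg Subtype.val
      (h e he fun n => ⟨C.rho (x n), subset_lClosure ⟨x n, rfl⟩⟩)
    rwa [hval, hval, eval_rho hC, eval_rho hC, heq] at this
  · intro h e he y
    choose x hx using fun n => mem_range_rho_of_mem_lClosure hC (y n).2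
    apply Subtype.ext
    simp only [hval, ← hx]
    rw [eval_rho hC, eval_rho hC, heq]
    exact h e he x

theorem IsNormal.variety_mem_H_iff (V : LGroupVariety) {C : PreCone G} (hC : C.IsNormal) :
    V.Mem C.H ↔ V.HoldsInCone (C : Set G) := by
  have h := C.isNormal_iff_core_eq.1 hC
  rw [PreCone.variety_mem_H_iff V (by rw [h]; exact C.mem_or_inv_mem), h]

variable [MulLeftMono G] [MulRightMono G]

/-- The largest pre-order contained in a right pre-order whose core is total. -/
def corePreCone (C : PreCone G) (hC : ∀ a, a ∈ C.core ∨ a⁻¹ ∈ C.core) : PreCone G where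
  carrier := C.core
  one_mem' t := by simpa using C.one_mem
  mul_mem' {a b} ha hb t := by
    have := C.mul_mem (ha t) (hb t)
    simpa [mul_assoc] using this
  proper h := C.proper (Set.univ_subset_iff.1 (h ▸ C.core_subset))
  total := hC
  pos_mem a ha t := by
    refine C.pos_mem _ ?_
    calc (1 : G) = t * 1 * t⁻¹ := by simp
      _ ≤ _ := by gcongr

theorem corePreCone_isNormal (C : PreCone G) (hC : ∀ a, a ∈ C.core ∨ a⁻¹ ∈ C.core) :
    (C.corePreCone hC).IsNormal := by
  intro a ha s t
  have : a ∈ C.core := ha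
  simpa [mul_assoc] using this (t * s⁻¹)

end

end PreCone

namespace RightPreorders

variable {V : LGroupVariety} {G : Type u} [Group G] [PartialOrder G]

theorem core_total (hV : LGroupVariety.IsRepresentable.{u} V) (C : RightPreorders V G) (a : G) :
    a ∈ C.1.core ∨ a⁻¹ ∈ C.1.core :=
  PreCone.core_total_of_isRepresentable (hV _ C.2) a

theorem basicOpen_eq (a : G) : basicOpen V a = {C : RightPreorders V G | a⁻¹ ∉ C.1} :=
  Set.ext fun _ => ⟨fun h => h.2, fun h => ⟨PreCone.mem_of_inv_notMem h, h⟩⟩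

theorem isOpen_basicOpen (a : G) : IsOpen (basicOpen V a) :=
  TopologicalSpace.isOpen_generateFrom_of_mem ⟨a, rfl⟩

end RightPreorders

/-! ### The topology of the space of pre-orders. -/

namespace Preorders

variable {V : LGroupVariety} {G : Type u} [Group G] [PartialOrder G]

/-- The set of pre-orders in which every element of `F` is strictly positive. -/
def basicOpen (V : LGroupVariety) (F : Finset G) : Set (Preorders V G) :=
  {C | ∀ a ∈ F, a⁻¹ ∉ C.1.1}

theorem isOpen_basicOpen (F : Finset G) : IsOpen (basicOpen V F) := by
  have : basicOpen V F = ⋂ a ∈ F, Subtype.val ⁻¹' RightPreorders.basicOpen V a := by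
    ext C
    simp [basicOpen, RightPreorders.basicOpen_eq]
  rw [this]
  exact isOpen_biInter_finset fun a _ =>
    (RightPreorders.isOpen_basicOpen a).preimage continuous_subtype_val

theorem basicOpen_union [DecidableEq G] (F F' : Finset G) :
    basicOpen V (F ∪ F') = basicOpen V F ∩ basicOpen V F' := by
  ext C
  simp [basicOpen, or_imp, forall_and]

theorem eq_generateFrom : (inferInstance : TopologicalSpace (Preorders V G)) =
    TopologicalSpace.generateFrom (Set.range fun a : G => basicOpen V {a}) := by
  refine induced_generateFrom_eq.trans ?_
  rw [← Set.range_comp]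
  congr 2
  ext a C
  simp [basicOpen, RightPreorders.basicOpen_eq]

/-- The empty `F` would give the whole space, which need not be compact; nonempty ones still cover
because cones are proper. -/
theorem isTopologicalBasis_basicOpen : TopologicalSpace.IsTopologicalBasis
    (Set.range fun F : {F : Finset G // F.Nonempty} => basicOpen V F.1) := by
  classical
  refine ⟨?_, Set.eq_univ_of_forall fun C => ?_, le_antisymm (le_generateFrom ?_) ?_⟩
  · rintro _ ⟨F, rfl⟩ _ ⟨F', rfl⟩ C hC
    exact ⟨_, ⟨⟨F.1 ∪ F'.1, F.2.mono Finset.subset_union_left⟩, rfl⟩,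
      (basicOpen_union F.1 F'.1).ge hC, (basicOpen_union F.1 F'.1).le⟩
  · obtain ⟨a, ha⟩ := C.1.1.exists_inv_notMem
    exact ⟨_, ⟨⟨{a}, Finset.singleton_nonempty a⟩, rfl⟩, by simpa [basicOpen] using ha⟩
  · rintro _ ⟨F, rfl⟩
    exact isOpen_basicOpen F.1
  · refine (TopologicalSpace.generateFrom_anti ?_).trans eq_generateFrom.ge
    rintro _ ⟨a, rfl⟩
    exact ⟨⟨{a}, Finset.singleton_nonempty a⟩, rfl⟩

/-- A finitely approximable proper set is the cone of a pre-order of the variety. -/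
theorem exists_coe_eq {D : Set G} (hD : D ≠ Set.univ)
    (h : ∀ F : Finset G, ∃ C : Preorders V G, ∀ a ∈ F, a ∈ C.1.1 ↔ a ∈ D) :
    ∃ C : Preorders V G, ∀ a, a ∈ C.1.1 ↔ a ∈ D := by
  classical
  let E : PreCone G :=
    { carrier := D
      one_mem' := by
        obtain ⟨C, hC⟩ := h {1}
        exact (hC 1 (by simp)).1 C.1.1.one_mem
      mul_mem' := fun {a b} ha hb => by
        obtain ⟨C, hC⟩ := h {a, b, a * b}
        exact (hC _ (by simp)).1 (C.1.1.mul_mem ((hC a (by simp)).2 ha) ((hC b (by simp)).2 hb))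
      proper := hD
      total := fun a => by
        obtain ⟨C, hC⟩ := h {a, a⁻¹}
        exact (C.1.1.mem_or_inv_mem a).imp (hC _ (by simp)).1 (hC _ (by simp)).1
      pos_mem := fun a ha => by
        obtain ⟨C, hC⟩ := h {a}
        exact (hC a (by simp)).1 (C.1.1.pos_mem a ha) }
  have hE : E.IsNormal := fun a ha t => by
    obtain ⟨C, hC⟩ := h {a, t⁻¹ * a * t}
    exact (hC _ (by simp)).1 (C.2 a ((hC a (by simp)).2 ha) t)
  refine ⟨⟨⟨E, (hE.variety_mem_H_iff V).2 (.of_finset fun F => ?_)⟩, hE⟩, fun a => Iff.rfl⟩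
  obtain ⟨C, hC⟩ := h F
  exact ⟨C.1.1, (PreCone.IsNormal.variety_mem_H_iff V C.2).1 C.1.2, hC⟩

theorem isCompact_basicOpen {F : Finset G} (hF : F.Nonempty) : IsCompact (basicOpen V F) := by
  rw [isCompact_iff_ultrafilter_le_nhds]
  intro f hf
  have hfF : ∀ᶠ C in (f : Filter (Preorders V G)), C ∈ basicOpen V F := Filter.le_principal_iff.1 hf
  -- The pointwise limit of the ultrafilter. Strict positivity on `F` passes to it, and nonemptiness
  -- of `F` keeps it proper.
  let D : Set G := {a | ∀ᶠ C in (f : Filter (Preorders V G)), a ∈ C.1.1}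
  have hlim : ∀ a, ∀ᶠ C in (f : Filter (Preorders V G)), a ∈ C.1.1 ↔ a ∈ D := fun a => by
    by_cases ha : a ∈ D
    · filter_upwards [show ∀ᶠ C in (f : Filter (Preorders V G)), a ∈ C.1.1 from ha] with C hC
      simp [hC, ha]
    · filter_upwards [Ultrafilter.eventually_not.2 ha] with C hC
      simp [hC, ha]
  have hDF : ∀ a ∈ F, a⁻¹ ∉ D := fun a ha h => by
    obtain ⟨C, h1, h2⟩ := (hfF.and h).exists
    exact h1 a ha h2
  obtain ⟨C, hC⟩ := exists_coe_eq (V := V) (D := D)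
    (fun h => by
      obtain ⟨a, ha⟩ := hF
      exact hDF a ha (h ▸ Set.mem_univ _))
    (fun F => ((Filter.eventually_all_finset F).2 fun a _ => hlim a).exists)
  refine ⟨C, fun a ha h => hDF a ha ((hC _).1 h), ?_⟩
  have hnhds := (isTopologicalBasis_basicOpen (V := V) (G := G)).nhds_hasBasis (a := C)
  rw [hnhds.ge_iff]
  rintro _ ⟨⟨F', rfl⟩, hCF'⟩
  have : ∀ᶠ E in (f : Filter (Preorders V G)), ∀ a ∈ F'.1, a⁻¹ ∉ E.1.1 :=
    (Filter.eventually_all_finset F'.1).2 fun a ha => by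
      filter_upwards [hlim a⁻¹] with E hE
      rw [hE, ← hC]
      exact hCF' a ha
  exact this

theorem mem_closure_iff_le {C D : Preorders V G} : D ∈ closure {C} ↔ C.1.1 ≤ D.1.1 := by
  rw [isTopologicalBasis_basicOpen.mem_closure_iff]
  constructor
  · intro h a ha
    by_contra hD
    have := h _ ⟨⟨{a⁻¹}, by simp⟩, rfl⟩ (by simpa [basicOpen] using hD)
    simp [basicOpen] at this
    exact this ha
  · rintro h _ ⟨F, rfl⟩ hD
    exact ⟨C, fun a ha hC => hD a ha (h hC), rfl⟩

/-- Closures are up-sets of single cones, so the generic point has to be the intersection of all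
cones in `Y`. -/
theorem exists_closure_eq {Y : Set (Preorders V G)} (hY : IsClosed Y) (hirr : IsIrreducible Y) :
    ∃ C, closure {C} = Y := by
  classical
  obtain ⟨C₀, hC₀⟩ := hirr.nonempty
  let D : Set G := {a | ∀ C ∈ Y, a ∈ C.1.1}
  have happrox : ∀ F : Finset G, ∃ C ∈ Y, ∀ a ∈ F, a ∈ C.1.1 ↔ a ∈ D := fun F => by
    -- Each `a ∈ F` outside `D` is omitted by some member of `Y`; irreducibility yields one member
    -- omitting all of them at once.
    obtain ⟨C, hCY, hC⟩ := isIrreducible_iff_sInter.1 hirr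
      ((F.filter (· ∉ D)).image fun a => basicOpen V {a⁻¹})
      (by simp only [Finset.mem_image]; rintro _ ⟨a, -, rfl⟩; exact isOpen_basicOpen _)
      (by
        simp only [Finset.mem_image, Finset.mem_filter]
        rintro _ ⟨a, ⟨-, ha⟩, rfl⟩
        simp only [D, Set.mem_ofPred_eq, not_forall] at ha
        obtain ⟨C, hC, ha⟩ := ha
        exact ⟨C, hC, by simpa [basicOpen] using ha⟩)
    refine ⟨C, hCY, fun a ha => ⟨fun h => ?_, fun h => h C hCY⟩⟩
    by_contra haD
    have := hC (basicOpen V {a⁻¹}) (by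
      simp only [Finset.coe_image, Finset.coe_filter]
      exact ⟨a, ⟨ha, haD⟩, rfl⟩)
    simp only [basicOpen, Finset.mem_singleton, forall_eq, inv_inv, Set.mem_ofPred_eq] at this
    exact this h
  obtain ⟨E, hE⟩ := exists_coe_eq (V := V) (D := D)
    (fun h => C₀.1.1.proper (Set.eq_univ_of_forall fun a => (h ▸ Set.mem_univ a : a ∈ D) C₀ hC₀))
    (fun F => (happrox F).imp fun _ h => h.2)
  refine ⟨E, Set.Subset.antisymm ?_ fun C hC => mem_closure_iff_le.2 fun a ha => (hE a).1 ha C hC⟩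
  refine closure_minimal (Set.singleton_subset_iff.2 ?_) hY
  rw [← hY.closure_eq, isTopologicalBasis_basicOpen.mem_closure_iff]
  rintro _ ⟨F, rfl⟩ hEF
  -- Basic opens test inverses, hence the approximation on `F⁻¹`.
  obtain ⟨C, hCY, hC⟩ := happrox (F.1.image (·⁻¹))
  refine ⟨C, fun a ha h => hEF a ha ((hE _).2 ((hC _ ?_).1 h)), hCY⟩
  exact Finset.mem_image_of_mem _ ha

theorem isGeneralisedSpectral (V : LGroupVariety) (G : Type u) [Group G] [PartialOrder G] :
    IsGeneralisedSpectral (Preorders V G) where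
  sober Y hY hirr := by
    obtain ⟨C, hC⟩ := exists_closure_eq hY hirr
    refine ⟨C, hC, fun D hD => Subtype.ext (Subtype.ext ?_)⟩
    refine le_antisymm (mem_closure_iff_le.1 ?_) (mem_closure_iff_le.1 ?_)
    · rw [show closure {D} = Y from hD, ← hC]; exact subset_closure rfl
    · rw [hC, ← show closure {D} = Y from hD]; exact subset_closure rfl
  isTopologicalBasis := (PrespectralSpace.of_isTopologicalBasis' isTopologicalBasis_basicOpen
    fun F => isCompact_basicOpen F.2).isTopologicalBasis
  isCompact_inter U W hU hUc hW hWc := by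
    classical
    have hb := isTopologicalBasis_basicOpen (V := V) (G := G)
    have hc := fun F : {F : Finset G // F.Nonempty} => isCompact_basicOpen (V := V) F.2
    obtain ⟨s, hs, rfl⟩ := (isCompact_open_iff_eq_finite_iUnion_of_isTopologicalBasis _ hb hc U).1
      ⟨hUc, hU⟩
    obtain ⟨t, ht, rfl⟩ := (isCompact_open_iff_eq_finite_iUnion_of_isTopologicalBasis _ hb hc W).1
      ⟨hWc, hW⟩
    rw [Set.iUnion₂_inter]
    refine hs.isCompact_biUnion fun F _ => ?_
    rw [Set.inter_iUnion₂]
    refine ht.isCompact_biUnion fun F' _ => ?_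
    rw [← basicOpen_union]
    exact isCompact_basicOpen (F.2.mono Finset.subset_union_left)

end Preorders

theorem theorem7p9 (G : Type u) [Group G] [PartialOrder G] [MulLeftMono G] [MulRightMono G]
    (V : LGroupVariety) (hV : LGroupVariety.IsRepresentable.{u} V) :
    -- the subspace of pre-orders is generalised spectral
    IsGeneralisedSpectral (Preorders V G) ∧
    -- `C ↦ ⋂ t, t⁻¹ C t` is a well-defined map on the right pre-orders of `V`
    ∃ β : RightPreorders V G → RightPreorders V G,
      (∀ C : RightPreorders V G,
        ((β C).1 : Set G) = ⋂ t : G, (fun c => t⁻¹ * c * t) '' (C.1 : Set G)) ∧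
      -- it is an interior operator, whose open elements are exactly the pre-orders
      IsInteriorOperator β ∧
      Function.fixedPoints β = Preorders V G ∧
      -- and it is a continuous retraction onto the space of pre-orders
      ∃ r : RightPreorders V G → Preorders V G,
        (∀ C, (r C : RightPreorders V G) = β C) ∧
        Continuous r ∧
        ∀ D : Preorders V G, r (D : RightPreorders V G) = D := by
  have htot := RightPreorders.core_total (G := G) hV
  let β : RightPreorders V G → RightPreorders V G := fun C =>
    ⟨C.1.corePreCone (htot C),
      -- Both memberships say that the equations hold in the same set `C.1.core`.
      ((C.1.corePreCone_isNormal (htot C)).variety_mem_H_iff V).2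
        ((PreCone.variety_mem_H_iff V (htot C)).1 C.2)⟩
  have hnormal : ∀ C, β C ∈ Preorders V G := fun C => C.1.corePreCone_isNormal (htot C)
  have hfix : ∀ C ∈ Preorders V G, β C = C := fun C hC =>
    Subtype.ext (SetLike.coe_injective (C.1.isNormal_iff_core_eq.1 hC))
  refine ⟨Preorders.isGeneralisedSpectral V G, β, fun C => C.1.core_eq_iInter,
    ⟨fun C => C.1.core_subset, fun C D h a ha t => h (ha t), fun C => hfix _ (hnormal C)⟩, ?_,
    fun C => ⟨β C, hnormal C⟩, fun C => rfl, ?_, fun D => Subtype.ext (hfix D.1 D.2)⟩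
  · exact Set.ext fun C => ⟨fun h => h ▸ hnormal C, hfix C⟩
  · refine Continuous.subtype_mk (continuous_generateFrom_iff.2 ?_) _
    rintro _ ⟨a, rfl⟩
    -- `a⁻¹` lies outside the core iff some conjugate of it lies outside `C`.
    have : β ⁻¹' RightPreorders.basicOpen V a =
        ⋃ t : G, RightPreorders.basicOpen V (t * a * t⁻¹) := by
      ext C
      have : a⁻¹ ∉ (β C).1 ↔ ¬ ∀ t : G, t * a⁻¹ * t⁻¹ ∈ C.1 := Iff.rfl
      simp only [RightPreorders.basicOpen_eq, Set.mem_preimage, Set.mem_ofPred_eq, Set.mem_iUnion,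
        this, not_forall]
      simp [mul_assoc]
    rw [this]
    exact isOpen_iUnion fun t => RightPreorders.isOpen_basicOpen _
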